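/- Let $Q\subset\mathbb R^K$ be a bounded open set, let $S\subset\mathbb R^M$ be a Borel set, and let $T:=\overline{\operatorname{conv}}\,S$ be the closed convex hull of $S$ (so $T=S$ if $S$ is closed and convex). Definitions. For $A\subset\mathbb R^M$ Borel, $L^1(Q;A)$ is the set of Lebesgue integrable $U:Q\to\mathbb R^M$ with $U(y)\in A$ for a.e. $y\in Q$, and $\mathcal P(A)$ is the set of Borel probability measures $\nu$ on $\mathbb R^M$ with $\nu(A)=1$. A Young measure on $Q$ with phase space $A$ is a family $\mathcal V=\{\mathcal V_y\}$ with $\mathcal V_y\in\mathcal P(A)$ for a.e. $y\in Q$ such that $y\mapsto\int g\,d\mathcal V_y$ is Lebesgue measurable on $Q$ for every $g\in C_c(\mathbb R^M)$. Young measures $\mathcal V^n$ $\mathcal K$-converge to a Young measure $\mathcal V$ if for every subsequence $(n_j)$ and for a.e. $y\in Q$, $$\frac1N\sum_{j=1}^N\int g\,d\mathcal V^{n_j}_y\to\int g\,d\mathcal V_y\quad(N\to\infty)\qquad\text{for all } g\in C_c(\mathbb R^M).$$ A sequence $U_n\in L^1(Q;A)$ weak-$\mathcal K$ converges to $U\in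 L^1(Q;A)$ (with phase space $A$) if, whenever for some subsequence $(n_j)$ the Young measures $\{\delta_{U_{n_j}(y)}\}_y$ $\mathcal K$-converge as $j\to\infty$ to a Young measure $\mathcal V$ on $Q$ with phase space $A$, then for a.e. $y\in Q$ the measure $\mathcal V_y$ has finite first moment and $U(y)=\int x\,d\mathcal V_y(x)$. Proposition. Let $U_n\in L^1(Q;S)$, $n=1,2,\dots$, satisfy $\int_Q|U_n|\,dy\le C$ for all $n$, with a constant $C$. Then there are a subsequence $(U_{n_k})$ and $U\in L^1(Q;T)$ such that $U_{n_k}$ weak-$\mathcal K$ converges to $U$ with phase space $T$. In addition, $$\frac1N\sum_{k=1}^N U_{n_k}\to U\quad\text{a.e. in } Q\text{ as }N\to\infty .$$ In particular, $U\in L^1(Q;S)$, and the weak-$\mathcal K$ convergence is with phase space $S$, if $S$ is closed and convex. -/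

import Mathlib

open MeasureTheory Filter Topology

noncomputable section

/-- `L¹(Q; S)`: (representatives of) integrable maps on `Q ⊆ ℝᴷ`, for Lebesgue measure, with values in
`S ⊆ ℝᴹ` almost everywhere. -/
def MemL1 {K M : ℕ} (Q : Set (EuclideanSpace ℝ (Fin K))) (S : Set (EuclideanSpace ℝ (Fin M)))
    (U : EuclideanSpace ℝ (Fin K) → EuclideanSpace ℝ (Fin M)) : Prop :=
  IntegrableOn U Q volume ∧ ∀ᵐ y ∂(volume.restrict Q), U y ∈ S

/-- `𝒫(S)`: the Borel probability measures `ν` on `ℝᴹ` with `ν(S) = 1`. -/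
def IsProbOn {M : ℕ} (S : Set (EuclideanSpace ℝ (Fin M)))
    (ν : Measure (EuclideanSpace ℝ (Fin M))) : Prop :=
  IsProbabilityMeasure ν ∧ ν S = 1

/-- Narrow convergence `⟨νₙ; g⟩ → ⟨ν; g⟩` for all `g ∈ C_c(ℝᴹ)`. (It is only used for probability
measures `νₙ`, `ν`.) -/
def NarrowTendsto {M : ℕ} (νs : ℕ → Measure (EuclideanSpace ℝ (Fin M)))
    (ν : Measure (EuclideanSpace ℝ (Fin M))) : Prop :=
  ∀ g : EuclideanSpace ℝ (Fin M) → ℝ, Continuous g → HasCompactSupport g →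
    Tendsto (fun n => ∫ x, g x ∂(νs n)) atTop (𝓝 (∫ x, g x ∂ν))

/-- A Young measure on `Q` with phase space `S`: a family `V y ∈ 𝒫(S)`, defined for almost every
`y ∈ Q`, such that `y ↦ ⟨V y; g⟩` is (Lebesgue) measurable on `Q` for every `g ∈ C_c(ℝᴹ)`. -/
def IsYoungMeasure {K M : ℕ} (Q : Set (EuclideanSpace ℝ (Fin K)))
    (S : Set (EuclideanSpace ℝ (Fin M)))
    (V : EuclideanSpace ℝ (Fin K) → Measure (EuclideanSpace ℝ (Fin M))) : Prop :=
  (∀ᵐ y ∂(volume.restrict Q), IsProbOn S (V y)) ∧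
  ∀ g : EuclideanSpace ℝ (Fin M) → ℝ, Continuous g → HasCompactSupport g →
    AEMeasurable (fun y => ∫ x, g x ∂(V y)) (volume.restrict Q)

/-- `𝒦`-convergence of a sequence of Young measures `Vs` to a Young measure `V`: for every
subsequence `φ`, the averages of the first `N + 1` members converge narrowly to `V y` as `N → ∞`,
for a.e. `y ∈ Q` (the null set may depend on the subsequence). -/
def KConverges {K M : ℕ} (Q : Set (EuclideanSpace ℝ (Fin K)))
    (S : Set (EuclideanSpace ℝ (Fin M)))
    (Vs : ℕ → EuclideanSpace ℝ (Fin K) → Measure (EuclideanSpace ℝ (Fin M)))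
    (V : EuclideanSpace ℝ (Fin K) → Measure (EuclideanSpace ℝ (Fin M))) : Prop :=
  (∀ n, IsYoungMeasure Q S (Vs n)) ∧ IsYoungMeasure Q S V ∧
  ∀ φ : ℕ → ℕ, StrictMono φ → ∀ᵐ y ∂(volume.restrict Q),
    NarrowTendsto
      (fun N => ((N : ENNReal) + 1)⁻¹ • ∑ k ∈ Finset.range (N + 1), Vs (φ k) y) (V y)

/-- The family of Dirac masses `y ↦ δ_{U(y)}`. -/
def diracYoung {K M : ℕ} (U : EuclideanSpace ℝ (Fin K) → EuclideanSpace ℝ (Fin M)) :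
    EuclideanSpace ℝ (Fin K) → Measure (EuclideanSpace ℝ (Fin M)) :=
  fun y => Measure.dirac (U y)

/-- Weak-`𝒦` convergence of `Uₙ ∈ L¹(Q; S)` to `W ∈ L¹(Q; S)`: whenever a subsequence of the Dirac
Young measures `𝒦`-converges to a Young measure `V`, then, for a.e. `y ∈ Q`, `V y` has a finite first
moment and `W y` is its barycenter. -/
def WeakKConverges {K M : ℕ} (Q : Set (EuclideanSpace ℝ (Fin K)))
    (S : Set (EuclideanSpace ℝ (Fin M)))
    (U : ℕ → EuclideanSpace ℝ (Fin K) → EuclideanSpace ℝ (Fin M))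
    (W : EuclideanSpace ℝ (Fin K) → EuclideanSpace ℝ (Fin M)) : Prop :=
  (∀ n, MemL1 Q S (U n)) ∧ MemL1 Q S W ∧
  ∀ φ : ℕ → ℕ, StrictMono φ →
    ∀ V : EuclideanSpace ℝ (Fin K) → Measure (EuclideanSpace ℝ (Fin M)),
      KConverges Q S (fun k => diracYoung (U (φ k))) V →
        ∀ᵐ y ∂(volume.restrict Q), Integrable (fun x => x) (V y) ∧ W y = ∫ x, x ∂(V y)

end

/-!
The proof rests on Komlós' theorem, obtained here by Etemadi's method for the strong law of large
numbers, and on a pointwise argument that turns convergence of averages into a barycenter formula.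

*Averages.* Let `f n ≥ 0` be bounded in `L¹(μ)`, `μ` finite. Along a subsequence every truncation
`min (f n) a`, `a ∈ ℕ`, converges weakly in `L²` to some `γ a`, and `γ a` increases a.e. to a finite
limit `g`. The increments satisfy `∑ₐ ∫ (γ (a + 1) - γ a) ≤ C`, and they control, for a sufficiently
sparse subsequence, both `∑ₖ μ(f k > k)` and `∑ₖ ‖min (f k) k‖² / k²`. A sparse subsequence can also
be chosen so that the functions `min (f k) a - γ a` for different `k` are almost orthogonal
(`exists_subseq_almostOrthogonalTruncations`). Summability of the second moments of the averages of
`min (f k) k - γ k` along the sequences `⌊cⁿ⌋` and monotonicity of the partial sums of the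
nonnegative functions `min (f k) k` then give convergence of the averages of `f k` to `g`; those of
`min (f k) a` converge to `γ a` in the same way. All conditions pass to further
subsequences, so the conclusion does too (`HasStableAverages`); hence finitely many sequences can be
treated one after the other, here `‖U n‖` and the positive and negative parts of the coordinates of
`U n` (`exists_subseq_stable_average`). This yields the limit `W` of the averages of `U n`; it is
integrable by Fatou's lemma and takes its values in the closed convex set
`closure (convexHull ℝ S)`.

*Barycenters.* Fix a point `y` and put `x k = U (n (φ k)) y`. The averages of `‖x k‖ - min ‖x k‖ a`
converge to `g y - γ a y`, which tends to `0` as `a → ∞`: almost everywhere the sequence `x k` is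
uniformly integrable in the mean, although no equi-integrability in `L¹(Q)` is assumed. If the
averages of the Dirac masses at `x k` converge narrowly to `ν`, the first moment can therefore be
taken to the limit, and `∫ x dν` is the limit `W y` of the averages of the `x k`
(`integrable_id_and_eq_integral_of_tendsto_average`).
-/

/-! ### Weak sequential compactness in a separable Hilbert space -/

/-- Countably many bounded sequences in a separable Hilbert space have weakly convergent
subsequences along one common extraction. The pairings with a countable dense set converge along a
subsequence because a countable product of compact intervals is sequentially compact. -/
theorem exists_subseq_forall_tendsto_inner {H : Type*} [NormedAddCommGroup H]
    [InnerProductSpace ℝ H] [CompleteSpace H] [TopologicalSpace.SeparableSpace H]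
    (x : ℕ → ℕ → H) (b : ℕ → ℝ) (hx : ∀ R n, ‖x R n‖ ≤ b R) :
    ∃ n : ℕ → ℕ, StrictMono n ∧ ∃ z : ℕ → H, ∀ R Y,
      Tendsto (fun k => inner ℝ (x R (n k)) Y) atTop (𝓝 (inner ℝ (z R) Y)) := by
  let e := TopologicalSpace.denseSeq H
  let s : ℕ → (ℕ × ℕ → ℝ) := fun n p => inner ℝ (x p.1 n) (e p.2)
  have hs : ∀ n, s n ∈ Set.pi Set.univ
      (fun p : ℕ × ℕ => Set.Icc (-(b p.1 * ‖e p.2‖)) (b p.1 * ‖e p.2‖)) := by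
    intro n p _
    refine Set.mem_Icc.2 (abs_le.1 ?_)
    exact (abs_real_inner_le_norm _ _).trans (by gcongr; exact hx _ _)
  obtain ⟨a, -, n, hn, ha⟩ :=
    (isCompact_univ_pi fun p : ℕ × ℕ => isCompact_Icc).tendsto_subseq hs
  rw [tendsto_pi_nhds] at ha
  refine ⟨n, hn, ?_⟩
  suffices h : ∀ R, ∃ z : H, ∀ Y,
      Tendsto (fun k => inner ℝ (x R (n k)) Y) atTop (𝓝 (inner ℝ z Y)) by
    choose z hz using h
    exact ⟨z, hz⟩
  intro R
  obtain ⟨l, -, ψ, hψ, hl⟩ := WeakDual.isSeqCompact_closedBall ℝ H (0 : StrongDual ℝ H) (b R)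
    (x := fun k => StrongDual.toWeakDual (InnerProductSpace.toDual ℝ H (x R (n k))))
    (fun k => by simpa using hx R (n k))
  obtain ⟨z, hz⟩ := (InnerProductSpace.toDual ℝ H).surjective (WeakDual.toStrongDual l)
  have hzl : ∀ Y, l Y = inner ℝ z Y := fun Y => by
    rw [← InnerProductSpace.toDual_apply_apply (𝕜 := ℝ), hz]; rfl
  have hlY : ∀ Y, Tendsto (fun k => inner ℝ (x R (n (ψ k))) Y) atTop (𝓝 (inner ℝ z Y)) := by
    intro Y
    have := (WeakBilin.eval_continuous _ Y).tendsto l |>.comp hl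
    rw [← hzl]
    exact this
  have hze : ∀ m, a (R, m) = inner ℝ z (e m) := fun m =>
    tendsto_nhds_unique ((ha (R, m)).comp hψ.tendsto_atTop) (hlY (e m))
  refine ⟨z, fun Y => ?_⟩
  rw [Metric.tendsto_atTop]
  intro ε hε
  have hB : 0 < b R + ‖z‖ + 1 := by
    have := (norm_nonneg _).trans (hx R 0); positivity
  obtain ⟨m, hm⟩ : ∃ m, dist Y (e m) < ε / 2 / (b R + ‖z‖ + 1) :=
    (TopologicalSpace.denseRange_denseSeq H).exists_dist_lt Y (by positivity)
  obtain ⟨N, hN⟩ := Metric.tendsto_atTop.1 (ha (R, m)) (ε / 2) (by positivity)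
  refine ⟨N, fun k hk => ?_⟩
  have h1 := hN k hk
  rw [hze, Real.dist_eq] at h1
  change |inner ℝ (x R (n k)) (e m) - _| < _ at h1
  rw [Real.dist_eq, ← inner_sub_left]
  rw [← inner_sub_left] at h1
  have h2 : inner ℝ (x R (n k) - z) Y
      = inner ℝ (x R (n k) - z) (e m) + inner ℝ (x R (n k) - z) (Y - e m) := by
    rw [← inner_add_right]; congr 1; abel
  have h3 : |inner ℝ (x R (n k) - z) (Y - e m)| ≤ ε / 2 := by
    calc _ ≤ ‖x R (n k) - z‖ * ‖Y - e m‖ := abs_real_inner_le_norm _ _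
      _ ≤ (b R + ‖z‖ + 1) * (ε / 2 / (b R + ‖z‖ + 1)) := by
        gcongr
        · exact (norm_sub_le _ _).trans (by linarith [hx R (n k)])
        · rw [← dist_eq_norm]; exact hm.le
      _ = ε / 2 := by field_simp
  rw [h2]
  exact (abs_add_le _ _).trans_lt (by linarith)

/-! ### Averages under a variance bound -/

theorem ae_summable_of_sum_integral_le {Ω : Type*} [MeasurableSpace Ω] {μ : Measure Ω}
    {F : ℕ → Ω → ℝ} (hF : ∀ n, Integrable (F n) μ) (h0 : ∀ n, ∀ᵐ y ∂μ, 0 ≤ F n y)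
    {B : ℝ} (hB : ∀ N, ∑ n ∈ Finset.range N, ∫ y, F n y ∂μ ≤ B) :
    ∀ᵐ y ∂μ, Summable fun n => F n y := by
  have h1 : ∫⁻ y, ∑' n, ENNReal.ofReal (F n y) ∂μ ≠ ⊤ := by
    rw [lintegral_tsum fun n => (hF n).aemeasurable.ennreal_ofReal]
    have hs : Summable fun n => ∫ y, F n y ∂μ :=
      summable_of_sum_range_le (fun n => integral_nonneg_of_ae (h0 n)) hB
    simp_rw [← fun n => ofReal_integral_eq_lintegral_ofReal (hF n) (h0 n)]
    rw [← ENNReal.ofReal_tsum_of_nonneg (fun n => integral_nonneg_of_ae (h0 n)) hs]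
    exact ENNReal.ofReal_ne_top
  filter_upwards [ae_lt_top' (AEMeasurable.tsum
    fun n => (hF n).aemeasurable.ennreal_ofReal) h1, ae_all_iff.2 h0] with y hy hy0
  exact (ENNReal.summable_toReal hy.ne).congr fun n => ENNReal.toReal_ofReal (hy0 n)

/-- The variance sums along the geometric sequence `⌊cⁿ⌋` are controlled by `∑ w i / i²`. The index
`0`, where `w i / i²` is a junk value, is excluded by `w 0 = 0`. -/
theorem sum_div_nat_floor_pow_sq_le {w : ℕ → ℝ} (hw : ∀ i, 0 ≤ w i) (hw0 : w 0 = 0) {B : ℝ}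
    (hB : ∀ L, ∑ i ∈ Finset.range L, w i / (i : ℝ) ^ 2 ≤ B) {c : ℝ} (hc : 1 < c) (N : ℕ) :
    ∑ n ∈ Finset.range N, (∑ i ∈ Finset.range ⌊c ^ n⌋₊, w i) / (⌊c ^ n⌋₊ : ℝ) ^ 2
      ≤ c ^ 5 * (c - 1)⁻¹ ^ 3 * B := by
  have hmono : Monotone fun n : ℕ => ⌊c ^ n⌋₊ :=
    fun i j hij => Nat.floor_mono (pow_right_mono₀ hc.le hij)
  have hK : 0 ≤ c ^ 5 * (c - 1)⁻¹ ^ 3 := by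
    have : 0 < c - 1 := sub_pos.2 hc
    positivity
  calc ∑ n ∈ Finset.range N, (∑ i ∈ Finset.range ⌊c ^ n⌋₊, w i) / (⌊c ^ n⌋₊ : ℝ) ^ 2
      = ∑ i ∈ Finset.range ⌊c ^ N⌋₊, w i *
          ∑ n ∈ Finset.range N with i < ⌊c ^ n⌋₊, 1 / (⌊c ^ n⌋₊ : ℝ) ^ 2 := by
        simp_rw [Finset.sum_div, Finset.mul_sum]
        rw [Finset.sum_comm' (t' := Finset.range ⌊c ^ N⌋₊)
          (s' := fun i => {n ∈ Finset.range N | i < ⌊c ^ n⌋₊})]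
        · simp_rw [mul_one_div]
        · intro n i
          simp only [Finset.mem_range, Finset.mem_filter]
          exact ⟨fun h => ⟨h, h.2.trans_le (hmono h.1.le)⟩, fun h => h.1⟩
    _ ≤ ∑ i ∈ Finset.range ⌊c ^ N⌋₊, c ^ 5 * (c - 1)⁻¹ ^ 3 * (w i / (i : ℝ) ^ 2) := by
        refine Finset.sum_le_sum fun i _ => ?_
        rcases Nat.eq_zero_or_pos i with rfl | hi
        · simp [hw0]
        · calc _ ≤ w i * (c ^ 5 * (c - 1)⁻¹ ^ 3 / (i : ℝ) ^ 2) := by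
                gcongr
                · exact hw i
                · have := sum_div_nat_floor_pow_sq_le_div_sq N (j := i) (by exact_mod_cast hi) hc
                  simpa only [Nat.cast_lt] using this
            _ = _ := by ring
    _ ≤ _ := by
        rw [← Finset.mul_sum]
        gcongr
        exact hB _

/-- Etemadi's argument. The second moments of the averages of `h i - β i` are summable along
`⌊cⁿ⌋` for every `c > 1`, so the averages of `h i` converge along these sequences; as `h i ≥ 0`, the
partial sums are monotone, and letting `c → 1` gives convergence of the whole sequence. -/
theorem ae_tendsto_average_of_sum_integral_sq_le {Ω : Type*} [MeasurableSpace Ω] {μ : Measure Ω}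
    (h β : ℕ → Ω → ℝ) (b : Ω → ℝ) (hh : ∀ i, ∀ᵐ y ∂μ, 0 ≤ h i y)
    (hL2 : ∀ i, MemLp (fun y => h i y - β i y) 2 μ)
    (w : ℕ → ℝ) (hw : ∀ i, 0 ≤ w i) (hw0 : w 0 = 0) (B : ℝ)
    (hB : ∀ L, ∑ i ∈ Finset.range L, w i / (i : ℝ) ^ 2 ≤ B)
    (hS : ∀ N, ∫ y, (∑ i ∈ Finset.range N, (h i y - β i y)) ^ 2 ∂μ ≤ ∑ i ∈ Finset.range N, w i)
    (hβ : ∀ᵐ y ∂μ, Tendsto (fun i => β i y) atTop (𝓝 (b y))) :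
    ∀ᵐ y ∂μ, Tendsto (fun N : ℕ => (∑ i ∈ Finset.range N, h i y) / N) atTop (𝓝 (b y)) := by
  have key : ∀ c : ℝ, 1 < c → ∀ᵐ y ∂μ, Tendsto (fun n : ℕ =>
      ((∑ i ∈ Finset.range ⌊c ^ n⌋₊, (h i y - β i y)) / ⌊c ^ n⌋₊) ^ 2) atTop (𝓝 0) := by
    intro c hc
    refine (ae_summable_of_sum_integral_le (fun n => ?_) (fun n => ae_of_all _ fun y => sq_nonneg _)
      (B := c ^ 5 * (c - 1)⁻¹ ^ 3 * B) (fun N => ?_)).mono fun y hy => hy.tendsto_atTop_zero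
    · simp_rw [div_pow]
      exact (memLp_finsetSum (Finset.range ⌊c ^ n⌋₊) fun i _ => hL2 i).integrable_sq.div_const _
    · refine le_trans (Finset.sum_le_sum fun n _ => ?_) (sum_div_nat_floor_pow_sq_le hw hw0 hB hc N)
      simp_rw [div_pow]
      rw [integral_div]
      gcongr
      exact hS _
  let c : ℕ → ℝ := fun k => 1 + 1 / ((k : ℝ) + 1)
  have hc1 : ∀ k, 1 < c k := fun k => by
    simp only [c, lt_add_iff_pos_right]; positivity
  have hclim : Tendsto c atTop (𝓝 1) := by
    simpa [c] using (tendsto_one_div_add_atTop_nhds_zero_nat (𝕜 := ℝ)).const_add 1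
  filter_upwards [ae_all_iff.2 fun k => key (c k) (hc1 k), ae_all_iff.2 hh, hβ] with y h1 h2 h3
  refine tendsto_div_of_monotone_of_tendsto_div_floor_pow
    (fun N => ∑ i ∈ Finset.range N, h i y) (b y)
    (fun m n hmn => Finset.sum_le_sum_of_subset_of_nonneg (Finset.range_mono hmn)
      fun i _ _ => h2 i) c hc1 hclim fun k => ?_
  have hfl : Tendsto (fun n : ℕ => ⌊c k ^ n⌋₊) atTop atTop :=
    tendsto_nat_floor_atTop.comp (tendsto_pow_atTop_atTop_of_one_lt (hc1 k))
  have h4 : Tendsto (fun n : ℕ =>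
      (∑ i ∈ Finset.range ⌊c k ^ n⌋₊, (h i y - β i y)) / ⌊c k ^ n⌋₊) atTop (𝓝 0) := by
    refine (tendsto_zero_iff_abs_tendsto_zero _).2 ?_
    have := (h1 k).sqrt
    simpa only [Real.sqrt_sq_eq_abs, Real.sqrt_zero, Function.comp_def] using this
  have h5 := h4.add (h3.cesaro.comp hfl)
  rw [zero_add] at h5
  refine h5.congr fun n => ?_
  simp only [Function.comp_apply, Finset.sum_sub_distrib]
  ring

/-! ### Sparse subsequences with almost orthogonal truncations -/

theorem exists_strictMono_forall_succ {E : ℕ → ℕ → Prop} (hE : ∀ p, ∀ᶠ n in atTop, E p n) :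
    ∃ n : ℕ → ℕ, StrictMono n ∧ ∀ k, E (n k) (n (k + 1)) := by
  choose N hN using fun p => eventually_atTop.1 (hE p)
  let n : ℕ → ℕ := fun k => Nat.rec 0 (fun _ p => max (p + 1) (N p)) k
  have hn : ∀ k, n (k + 1) = max (n k + 1) (N (n k)) := fun k => rfl
  refine ⟨n, strictMono_nat_of_lt_succ fun k => ?_, fun k => hN _ _ ?_⟩
  · rw [hn]; exact Nat.lt_of_succ_le (le_max_left _ _)
  · rw [hn]; exact le_max_right _ _

section
variable {Ω : Type*} [MeasurableSpace Ω] {μ : Measure Ω}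

/-- Weak `L²` limits along one subsequence for countably many uniformly bounded sequences. -/
theorem exists_subseq_tendsto_integral_mul [MeasurableSpace.CountablyGenerated Ω]
    [IsFiniteMeasure μ] (g : ℕ → ℕ → Ω → ℝ) (hg : ∀ a n, AEStronglyMeasurable (g a n) μ)
    (b : ℕ → ℝ) (hb : ∀ a n y, |g a n y| ≤ b a) :
    ∃ n : ℕ → ℕ, StrictMono n ∧ ∃ γ : ℕ → Ω → ℝ, (∀ a, MemLp (γ a) 2 μ) ∧
      ∀ a (Y : Ω → ℝ), MemLp Y 2 μ →
        Tendsto (fun k => ∫ y, g a (n k) y * Y y ∂μ) atTop (𝓝 (∫ y, γ a y * Y y ∂μ)) := by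
  have hmem : ∀ a n, MemLp (g a n) 2 μ := fun a n =>
    MemLp.of_bound (hg a n) (b a) (ae_of_all _ fun y => hb a n y)
  have hb0 : ∀ a (_ : Ω), 0 ≤ b a := fun a y => (abs_nonneg _).trans (hb a 0 y)
  have : Fact ((1 : ENNReal) ≤ 2) := ⟨by norm_num⟩
  have : Fact ((2 : ENNReal) ≠ ⊤) := ⟨by norm_num⟩
  obtain ⟨n, hn, z, hz⟩ := exists_subseq_forall_tendsto_inner
    (fun a n => (hmem a n).toLp (g a n))
    (fun a => (μ Set.univ ^ (2 : ENNReal).toReal⁻¹ * ENNReal.ofReal (b a)).toReal) (fun a n => by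
      rw [Lp.norm_toLp]
      refine ENNReal.toReal_mono ?_ (eLpNorm_le_of_ae_bound (ae_of_all _ fun y => hb a n y))
      exact ENNReal.mul_ne_top (ENNReal.rpow_ne_top_of_nonneg (by positivity)
        (measure_ne_top _ _)) ENNReal.ofReal_ne_top)
  refine ⟨n, hn, fun a => z a, fun a => Lp.memLp (z a), fun a Y hY => ?_⟩
  have h := hz a (hY.toLp Y)
  simp only [L2.inner_def] at h
  have e1 : ∀ k, ∫ y, inner ℝ ((hmem a (n k)).toLp (g a (n k)) y) (hY.toLp Y y) ∂μ
      = ∫ y, g a (n k) y * Y y ∂μ := fun k => by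
    refine integral_congr_ae ?_
    filter_upwards [(hmem a (n k)).coeFn_toLp, hY.coeFn_toLp] with y h1 h2
    rw [h1, h2, real_inner_comm]; rfl
  have e2 : ∫ y, inner ℝ (z a y) (hY.toLp Y y) ∂μ = ∫ y, z a y * Y y ∂μ := by
    refine integral_congr_ae ?_
    filter_upwards [hY.coeFn_toLp] with y h2
    rw [h2, real_inner_comm]; rfl
  simpa only [e1, e2] using h

/-- The square of a truncation as a telescoping sum. Applied to `f k` and integrated, it bounds
`‖min (f k) a‖²` by the masses of the increments of the truncations. -/
theorem min_natCast_sq_le {x : ℝ} (hx : 0 ≤ x) (a : ℕ) :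
    (min x a) ^ 2 ≤ ∑ j ∈ Finset.range a,
      (2 * (j : ℝ) + 1) * (min x ((j + 1 : ℕ) : ℝ) - min x j) := by
  induction a with
  | zero => simp [hx]
  | succ a ih =>
    rw [Finset.sum_range_succ]
    have h1 : min x a ≤ min x ((a + 1 : ℕ) : ℝ) := min_le_min_left _ (by push_cast; linarith)
    have h2 : min x ((a + 1 : ℕ) : ℝ) ≤ a + 1 := by push_cast; exact min_le_right _ _
    have h3 : min x a ≤ a := min_le_right _ _
    nlinarith

theorem memLp_min_natCast [IsFiniteMeasure μ] {f : Ω → ℝ} (hf : AEStronglyMeasurable f μ)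
    (h0 : ∀ y, 0 ≤ f y) (a : ℕ) (p : ENNReal) : MemLp (fun y => min (f y) a) p μ := by
  refine MemLp.of_bound (hf.inf aestronglyMeasurable_const) a (ae_of_all _ fun y => ?_)
  change |min (f y) (a : ℝ)| ≤ _
  rw [abs_of_nonneg (le_min (h0 y) (Nat.cast_nonneg a))]
  exact min_le_right _ _

/-- The integrable functions `f k ≥ 0` have truncations `min (f k) a`, `a ∈ ℕ`, that behave like
almost orthogonal perturbations of the fixed functions `γ a`: in `cross` the inner products of
`min (f k) a - γ a` with the corresponding functions of smaller index are small, `diag` bounds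
`⟪min (f k) a - γ a, γ a⟫` below, so that `‖min (f k) a - γ a‖² ≤ ‖min (f k) a‖² + 2`, and `incr`
bounds the mass of `f k` between the levels `a` and `a + 1` by that of the limits `γ`.
The bounds concern levels up to `k` only and weaken as `k` decreases, which makes them stable under
passing to subsequences. -/
structure AlmostOrthogonalTruncations (μ : Measure Ω) (f γ : ℕ → Ω → ℝ) (C : ℝ) : Prop where
  integrable : ∀ k, Integrable (f k) μ
  nonneg : ∀ k y, 0 ≤ f k y
  memLp : ∀ a, MemLp (γ a) 2 μ
  zero : γ 0 =ᵐ[μ] 0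
  mono : ∀ a, γ a ≤ᵐ[μ] γ (a + 1)
  integral_le : ∀ a, ∫ y, γ a y ∂μ ≤ C
  cross : ∀ k : ℕ, 1 ≤ k → ∀ j < k, ∀ a ≤ k, ∀ b ≤ k,
    ∫ y, (min (f k y) a - γ a y) * (min (f j y) b - γ b y) ∂μ ≤ 1 / (2 * ((k : ℝ) + 1))
  diag : ∀ k : ℕ, 1 ≤ k → ∀ a ≤ k, -1 ≤ ∫ y, (min (f k y) a - γ a y) * γ a y ∂μ
  incr : ∀ k : ℕ, 1 ≤ k → ∀ a ≤ k, ∫ y, (min (f k y) ((a + 1 : ℕ) : ℝ) - min (f k y) a) ∂μ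
    ≤ ∫ y, (γ (a + 1) y - γ a y) ∂μ + 1 / ((k : ℝ) + 1) ^ 2

/-- The `γ a` are weak `L²` limits of `min (f n) a`. All the required bounds then hold for large `n`,
and each index is chosen large depending on the preceding one. -/
theorem exists_subseq_almostOrthogonalTruncations [MeasurableSpace.CountablyGenerated Ω]
    [IsFiniteMeasure μ] {f : ℕ → Ω → ℝ} (hf : ∀ n, Integrable (f n) μ) (h0 : ∀ n y, 0 ≤ f n y)
    {C : ℝ} (hC : ∀ n, ∫ y, f n y ∂μ ≤ C) :
    ∃ n : ℕ → ℕ, StrictMono n ∧ ∃ γ : ℕ → Ω → ℝ,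
      AlmostOrthogonalTruncations μ (fun k => f (n k)) γ C := by
  have hg : ∀ (n a : ℕ), MemLp (fun y => min (f n y) (a : ℝ)) 2 μ := fun n a =>
    memLp_min_natCast (hf n).1 (h0 n) a 2
  obtain ⟨m, hm, γ, hγ, hlim⟩ := exists_subseq_tendsto_integral_mul (μ := μ)
    (fun a n y => min (f n y) (a : ℝ)) (fun a n => (hg n a).1) (fun a => a) (fun a n y => by
      rw [abs_of_nonneg (le_min (h0 n y) (Nat.cast_nonneg a))]
      exact min_le_right _ _)
  have hγ1 : ∀ a, Integrable (γ a) μ := fun a => (hγ a).integrable (by norm_num)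
  have hg1 : ∀ (n a : ℕ), Integrable (fun y => min (f n y) (a : ℝ)) μ := fun n a =>
    (hg n a).integrable (by norm_num)
  have hset : ∀ (a : ℕ) (A : Set Ω), MeasurableSet A →
      Tendsto (fun k => ∫ y in A, min (f (m k) y) (a : ℝ) ∂μ) atTop (𝓝 (∫ y in A, γ a y ∂μ)) := by
    intro a A hA
    have := hlim a (A.indicator fun _ => 1) ((memLp_const 1).indicator hA)
    have e : ∀ u : Ω → ℝ, ∫ y, u y * A.indicator (fun _ => (1 : ℝ)) y ∂μ = ∫ y in A, u y ∂μ := by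
      intro u
      rw [← integral_indicator hA]
      congr 1; ext y
      by_cases hy : y ∈ A <;> simp [hy]
    simpa only [e] using this
  have hint : ∀ a : ℕ, Tendsto (fun k => ∫ y, min (f (m k) y) (a : ℝ) ∂μ) atTop
      (𝓝 (∫ y, γ a y ∂μ)) := fun a => by
    simpa using hset a Set.univ MeasurableSet.univ
  have hsub : ∀ (a : ℕ) (Y : Ω → ℝ), MemLp Y 2 μ → Tendsto
      (fun k => ∫ y, (min (f (m k) y) (a : ℝ) - γ a y) * Y y ∂μ) atTop (𝓝 0) := by
    intro a Y hY
    have h1 := (hlim a Y hY).sub_const (∫ y, γ a y * Y y ∂μ)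
    rw [sub_self] at h1
    refine h1.congr fun k => ?_
    refine (integral_sub ((hg (m k) a).integrable_mul hY) ((hγ a).integrable_mul hY)).symm.trans ?_
    simp only [sub_mul, Pi.mul_apply]
  have hincr : ∀ a, Tendsto
      (fun k => ∫ y, (min (f (m k) y) ((a + 1 : ℕ) : ℝ) - min (f (m k) y) a) ∂μ) atTop
      (𝓝 (∫ y, (γ (a + 1) y - γ a y) ∂μ)) := by
    intro a
    rw [integral_sub (hγ1 _) (hγ1 _)]
    refine ((hint (a + 1)).sub (hint a)).congr fun k => ?_
    rw [integral_sub (hg1 _ _) (hg1 _ _)]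
  -- `q` is the preceding index of the subsequence and `k` the next one. The position of `k` in the
  -- subsequence is at most `q + 1`, whence the levels up to `q + 1` and the tolerances in `q + 2`.
  obtain ⟨n, hn, hE⟩ := exists_strictMono_forall_succ (E := fun q k =>
    (∀ a ∈ Set.Iic (q + 1), ∀ b ∈ Set.Iic (q + 1), ∀ j ∈ Set.Iic q,
      ∫ y, (min (f (m k) y) a - γ a y) * (min (f (m j) y) b - γ b y) ∂μ
        ≤ 1 / (2 * ((q : ℝ) + 2))) ∧
    (∀ a ∈ Set.Iic (q + 1), -1 ≤ ∫ y, (min (f (m k) y) a - γ a y) * γ a y ∂μ) ∧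
    (∀ a ∈ Set.Iic (q + 1), ∫ y, (min (f (m k) y) ((a + 1 : ℕ) : ℝ) - min (f (m k) y) a) ∂μ
      ≤ ∫ y, (γ (a + 1) y - γ a y) ∂μ + 1 / ((q : ℝ) + 2) ^ 2)) (by
    intro q
    refine Eventually.and ?_ (Eventually.and ?_ ?_)
    · refine (eventually_all_finite (Set.finite_Iic _)).2 fun a _ =>
        (eventually_all_finite (Set.finite_Iic _)).2 fun b _ =>
        (eventually_all_finite (Set.finite_Iic _)).2 fun j _ => ?_
      exact (hsub a _ ((hg (m j) b).sub (hγ b))).eventually_le_const (by positivity)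
    · refine (eventually_all_finite (Set.finite_Iic _)).2 fun a _ => ?_
      exact (hsub a _ (hγ a)).eventually_const_le (by norm_num : (-1 : ℝ) < 0)
    · refine (eventually_all_finite (Set.finite_Iic _)).2 fun a _ => ?_
      exact (hincr a).eventually_le_const (lt_add_of_pos_right _ (by positivity)))
  have hpred : ∀ k : ℕ, 1 ≤ k → ∃ i, k = i + 1 ∧ (k : ℝ) + 1 ≤ (n i : ℝ) + 2 ∧ k ≤ n i + 1 := by
    intro k hk
    obtain ⟨i, rfl⟩ := Nat.exists_eq_add_of_le' hk
    have : i ≤ n i := hn.le_apply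
    refine ⟨i, rfl, ?_, by omega⟩
    have : (i : ℝ) ≤ n i := by exact_mod_cast this
    push_cast; linarith
  refine ⟨fun k => m (n k), hm.comp hn, γ, ?_⟩
  constructor
  · exact fun k => hf _
  · exact fun k => h0 _
  · exact hγ
  · have h1 := hlim 0 (γ 0) (hγ 0)
    have h2 : ∀ k y, min (f (m k) y) ((0 : ℕ) : ℝ) = 0 := fun k y => by simp [h0]
    simp only [h2, zero_mul, integral_zero] at h1
    have h3 := tendsto_nhds_unique h1 tendsto_const_nhds
    rw [integral_eq_zero_iff_of_nonneg (fun y => mul_self_nonneg _)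
      ((hγ 0).integrable_mul (hγ 0))] at h3
    filter_upwards [h3] with y hy
    simpa using hy
  · refine fun a => ae_le_of_forall_setIntegral_le (hγ1 _) (hγ1 _) fun A hA _ => ?_
    refine le_of_tendsto_of_tendsto' (hset a A hA) (hset (a + 1) A hA) fun k => ?_
    refine integral_mono (hg1 _ _).integrableOn (hg1 _ _).integrableOn fun y => ?_
    exact min_le_min_left _ (by push_cast; linarith)
  · exact fun a => le_of_tendsto' (hint a) fun k =>
      (integral_mono (hg1 _ _) (hf _) fun y => min_le_left _ _).trans (hC _)
  · intro k hk j hj a ha b hb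
    obtain ⟨i, rfl, h1, h2⟩ := hpred k hk
    refine ((hE i).1 a (ha.trans h2) b (hb.trans h2) (n j)
      (hn.monotone (Nat.lt_succ_iff.1 hj))).trans ?_
    gcongr
  · intro k hk a ha
    obtain ⟨i, rfl, h1, h2⟩ := hpred k hk
    exact (hE i).2.1 a (ha.trans h2)
  · intro k hk a ha
    obtain ⟨i, rfl, h1, h2⟩ := hpred k hk
    refine ((hE i).2.2 a (ha.trans h2)).trans ?_
    gcongr
end

/-! ### Averages of almost orthogonal truncations -/

theorem sum_sum_range_div_sq_le {d : ℕ → ℝ} (hd : ∀ j, 0 ≤ d j) {C : ℝ}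
    (hC : ∀ N, ∑ j ∈ Finset.range N, d j ≤ C) (L : ℕ) :
    ∑ i ∈ Finset.Ioo 0 L, (4 + ∑ j ∈ Finset.range i, (2 * (j : ℝ) + 1) * d j) / (i : ℝ) ^ 2
      ≤ 8 + 4 * C := by
  have h1 : ∑ i ∈ Finset.Ioo 0 L, ((i : ℝ) ^ 2)⁻¹ ≤ 2 := by
    simpa using sum_Ioo_inv_sq_le (α := ℝ) 0 L
  have h2 : ∑ i ∈ Finset.Ioo 0 L, ∑ j ∈ Finset.range i, (2 * (j : ℝ) + 1) * d j * ((i : ℝ) ^ 2)⁻¹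
      = ∑ j ∈ Finset.range L, (2 * (j : ℝ) + 1) * d j * ∑ i ∈ Finset.Ioo j L, ((i : ℝ) ^ 2)⁻¹ := by
    simp_rw [Finset.mul_sum]
    refine Finset.sum_comm' fun i j => ?_
    simp only [Finset.mem_Ioo, Finset.mem_range]
    omega
  have h3 : ∑ j ∈ Finset.range L, (2 * (j : ℝ) + 1) * d j * ∑ i ∈ Finset.Ioo j L, ((i : ℝ) ^ 2)⁻¹
      ≤ ∑ j ∈ Finset.range L, 4 * d j := by
    refine Finset.sum_le_sum fun j _ => ?_
    calc (2 * (j : ℝ) + 1) * d j * ∑ i ∈ Finset.Ioo j L, ((i : ℝ) ^ 2)⁻¹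
        ≤ (2 * (j : ℝ) + 1) * d j * (2 / (j + 1)) := by
          gcongr
          · exact mul_nonneg (by positivity) (hd j)
          · exact sum_Ioo_inv_sq_le j L
      _ ≤ 4 * d j := by
          rw [mul_div_assoc', div_le_iff₀ (by positivity)]
          nlinarith [hd j]
  rw [← Finset.mul_sum] at h3
  simp_rw [div_eq_mul_inv, add_mul (4 : ℝ)]
  rw [Finset.sum_add_distrib, ← Finset.mul_sum]
  simp_rw [Finset.sum_mul]
  rw [h2]
  linarith [hC L]

section
variable {Ω : Type*} [MeasurableSpace Ω] {μ : Measure Ω}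

namespace AlmostOrthogonalTruncations
variable {f γ : ℕ → Ω → ℝ} {C : ℝ}

theorem integral_increment_nonneg (H : AlmostOrthogonalTruncations μ f γ C) (a : ℕ) :
    0 ≤ ∫ y, (γ (a + 1) y - γ a y) ∂μ :=
  integral_nonneg_of_ae ((H.mono a).mono fun _ h => sub_nonneg.2 h)

variable [IsFiniteMeasure μ]

theorem memLp_min (H : AlmostOrthogonalTruncations μ f γ C) (k a : ℕ) :
    MemLp (fun y => min (f k y) (a : ℝ)) 2 μ :=
  memLp_min_natCast (H.integrable k).1 (H.nonneg k) a 2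

theorem memLp_sub (H : AlmostOrthogonalTruncations μ f γ C) (k a : ℕ) :
    MemLp (fun y => min (f k y) (a : ℝ) - γ a y) 2 μ :=
  (H.memLp_min k a).sub (H.memLp a)

theorem sum_integral_increment_le (H : AlmostOrthogonalTruncations μ f γ C) (N : ℕ) :
    ∑ a ∈ Finset.range N, ∫ y, (γ (a + 1) y - γ a y) ∂μ ≤ C := by
  have h1 : ∀ a, Integrable (γ a) μ := fun a => (H.memLp a).integrable (by norm_num)
  simp_rw [fun a => integral_sub (h1 (a + 1)) (h1 a)]
  rw [Finset.sum_range_sub (fun a => ∫ y, γ a y ∂μ), integral_congr_ae H.zero]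
  simpa using H.integral_le N

theorem exists_ae_tendsto (H : AlmostOrthogonalTruncations μ f γ C) :
    ∃ g : Ω → ℝ, ∀ᵐ y ∂μ, Tendsto (fun a => γ a y) atTop (𝓝 (g y)) := by
  have h1 : ∀ a, Integrable (γ a) μ := fun a => (H.memLp a).integrable (by norm_num)
  refine ⟨fun y => ∑' a, (γ (a + 1) y - γ a y), ?_⟩
  filter_upwards [ae_summable_of_sum_integral_le (fun a => (h1 (a + 1)).sub (h1 a))
    (fun a => (H.mono a).mono fun _ h => sub_nonneg.2 h) H.sum_integral_increment_le, H.zero]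
    with y hy hy0
  refine hy.hasSum.tendsto_sum_nat.congr fun N => ?_
  simp only [Pi.sub_apply]
  rw [Finset.sum_range_sub (fun a => γ a y), hy0]
  simp

theorem integral_min_sq_le (H : AlmostOrthogonalTruncations μ f γ C) {k a i : ℕ} (hk : 1 ≤ k)
    (hak : a ≤ k) (hai : a ≤ i) :
    ∫ y, (min (f k y) a) ^ 2 ∂μ ≤
      1 + ∑ j ∈ Finset.range i, (2 * (j : ℝ) + 1) * ∫ y, (γ (j + 1) y - γ j y) ∂μ := by
  have h1 : ∀ a : ℕ, Integrable (fun y => min (f k y) (a : ℝ)) μ := fun a =>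
    (H.memLp_min k a).integrable (by norm_num)
  have h2 : ∀ j : ℕ, Integrable (fun y => (2 * (j : ℝ) + 1) *
      (min (f k y) ((j + 1 : ℕ) : ℝ) - min (f k y) j)) μ := fun j =>
    ((h1 (j + 1)).sub (h1 j)).const_mul _
  have hsum : ∀ a : ℕ, ∑ j ∈ Finset.range a, (2 * (j : ℝ) + 1) = (a : ℝ) ^ 2 := by
    intro a
    induction a with
    | zero => simp
    | succ a ih => rw [Finset.sum_range_succ, ih]; push_cast; ring
  calc ∫ y, (min (f k y) a) ^ 2 ∂μ
      ≤ ∫ y, ∑ j ∈ Finset.range a,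
          (2 * (j : ℝ) + 1) * (min (f k y) ((j + 1 : ℕ) : ℝ) - min (f k y) j) ∂μ :=
        integral_mono (H.memLp_min k a).integrable_sq
          (integrable_finsetSum _ fun j _ => h2 j)
          fun y => min_natCast_sq_le (H.nonneg k y) a
    _ = ∑ j ∈ Finset.range a, (2 * (j : ℝ) + 1) *
          ∫ y, (min (f k y) ((j + 1 : ℕ) : ℝ) - min (f k y) j) ∂μ := by
        rw [integral_finsetSum _ fun j _ => h2 j]
        simp_rw [integral_const_mul]
    _ ≤ ∑ j ∈ Finset.range a, (2 * (j : ℝ) + 1) *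
          (∫ y, (γ (j + 1) y - γ j y) ∂μ + 1 / ((k : ℝ) + 1) ^ 2) := by
        refine Finset.sum_le_sum fun j hj => ?_
        gcongr
        exact H.incr k hk j ((Finset.mem_range.1 hj).le.trans hak)
    _ = (a : ℝ) ^ 2 / ((k : ℝ) + 1) ^ 2 +
          ∑ j ∈ Finset.range a, (2 * (j : ℝ) + 1) * ∫ y, (γ (j + 1) y - γ j y) ∂μ := by
        simp_rw [mul_add, Finset.sum_add_distrib, ← Finset.sum_mul, hsum]
        ring
    _ ≤ _ := by
        have hak' : (a : ℝ) ≤ k := by exact_mod_cast hak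
        refine add_le_add ?_ ?_
        · refine div_le_one_of_le₀ ?_ (by positivity)
          gcongr
          linarith
        · exact Finset.sum_le_sum_of_subset_of_nonneg (Finset.range_mono hai) fun j _ _ =>
            mul_nonneg (by positivity) (H.integral_increment_nonneg j)

theorem integral_sub_sq_le (H : AlmostOrthogonalTruncations μ f γ C) {k a i : ℕ} (hk : 1 ≤ k)
    (hak : a ≤ k) (hai : a ≤ i) :
    ∫ y, (min (f k y) a - γ a y) ^ 2 ∂μ ≤
      3 + ∑ j ∈ Finset.range i, (2 * (j : ℝ) + 1) * ∫ y, (γ (j + 1) y - γ j y) ∂μ := by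
  have h1 := H.integral_min_sq_le hk hak hai
  have h2 := H.diag k hk a hak
  have i1 := (H.memLp_min k a).integrable_sq
  have i2 : Integrable (fun y => (min (f k y) a - γ a y) * γ a y) μ :=
    (H.memLp_sub k a).integrable_mul (H.memLp a)
  calc ∫ y, (min (f k y) a - γ a y) ^ 2 ∂μ
      ≤ ∫ y, ((min (f k y) a) ^ 2 - 2 * ((min (f k y) a - γ a y) * γ a y)) ∂μ :=
        integral_mono (H.memLp_sub k a).integrable_sq (i1.sub (i2.const_mul 2))
          fun y => by nlinarith [sq_nonneg (γ a y)]
    _ = ∫ y, (min (f k y) a) ^ 2 ∂μ - 2 * ∫ y, (min (f k y) a - γ a y) * γ a y ∂μ := by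
        rw [integral_sub i1 (i2.const_mul 2), integral_const_mul]
    _ ≤ _ := by linarith

/-- The truncation levels `r i ≤ i` allow both a fixed level, eventually, and the growing level `i`.
The cross terms of index `N` add up to at most `N / (N + 1) ≤ 1`. -/
theorem integral_sum_sq_le (H : AlmostOrthogonalTruncations μ f γ C) {φ : ℕ → ℕ}
    (hφ : StrictMono φ) {r : ℕ → ℕ} (hr : ∀ i, r i ≤ i) (N : ℕ) :
    ∫ y, (∑ i ∈ Finset.range N, (min (f (φ i) y) (r i) - γ (r i) y)) ^ 2 ∂μ ≤
      ∑ i ∈ Finset.range N, if i = 0 then 0 else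
        4 + ∑ j ∈ Finset.range i, (2 * (j : ℝ) + 1) * ∫ y, (γ (j + 1) y - γ j y) ∂μ := by
  induction N with
  | zero => simp
  | succ N ih =>
    set X : ℕ → Ω → ℝ := fun i y => min (f (φ i) y) (r i) - γ (r i) y with hX
    have hX2 : ∀ i, MemLp (X i) 2 μ := fun i => H.memLp_sub _ _
    rw [Finset.sum_range_succ]
    rcases Nat.eq_zero_or_pos N with rfl | hN
    · have hr0 : r 0 = 0 := Nat.le_zero.1 (hr 0)
      have : (fun y => (∑ i ∈ Finset.range (0 + 1), X i y) ^ 2) =ᵐ[μ] fun _ => 0 := by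
        filter_upwards [H.zero] with y hy
        simp [hX, hr0, hy, H.nonneg]
      change ∫ y, (∑ i ∈ Finset.range (0 + 1), X i y) ^ 2 ∂μ ≤ _
      rw [integral_congr_ae this]
      simp
    · have hS2 : MemLp (fun y => ∑ i ∈ Finset.range N, X i y) 2 μ :=
        memLp_finsetSum _ fun i _ => hX2 i
      have hi : ∀ i, Integrable (fun y => X N y * X i y) μ := fun i =>
        (hX2 N).integrable_mul (hX2 i)
      have hNφ : N ≤ φ N := hφ.le_apply
      have hcross : ∫ y, X N y * ∑ i ∈ Finset.range N, X i y ∂μ ≤ 1 / 2 := by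
        simp_rw [Finset.mul_sum]
        rw [integral_finsetSum _ fun i _ => hi i]
        calc ∑ i ∈ Finset.range N, ∫ y, X N y * X i y ∂μ
            ≤ ∑ i ∈ Finset.range N, 1 / (2 * ((φ N : ℝ) + 1)) := by
              refine Finset.sum_le_sum fun i hi => ?_
              have hiN := Finset.mem_range.1 hi
              exact H.cross (φ N) (hN.trans_le hNφ) (φ i) (hφ hiN) (r N)
                ((hr N).trans hNφ) (r i) (((hr i).trans hiN.le).trans hNφ)
          _ ≤ 1 / 2 := by
              have : (N : ℝ) ≤ φ N := by exact_mod_cast hNφ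
              rw [Finset.sum_const, Finset.card_range, nsmul_eq_mul, mul_one_div,
                div_le_div_iff₀ (by positivity) (by positivity)]
              linarith
      have hdiag := H.integral_sub_sq_le (hN.trans_le hNφ) ((hr N).trans hNφ) (hr N)
      have hexp : ∫ y, (∑ i ∈ Finset.range (N + 1), X i y) ^ 2 ∂μ
          = ∫ y, (∑ i ∈ Finset.range N, X i y) ^ 2 ∂μ
            + 2 * ∫ y, X N y * ∑ i ∈ Finset.range N, X i y ∂μ + ∫ y, X N y ^ 2 ∂μ := by
        have i2 : Integrable (fun y => X N y * ∑ i ∈ Finset.range N, X i y) μ :=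
          (hX2 N).integrable_mul hS2
        have i3 : Integrable (fun y => (∑ i ∈ Finset.range N, X i y) ^ 2
            + 2 * (X N y * ∑ i ∈ Finset.range N, X i y)) μ :=
          hS2.integrable_sq.add (i2.const_mul 2)
        rw [← integral_const_mul, ← integral_add hS2.integrable_sq (i2.const_mul 2),
          ← integral_add i3 (hX2 N).integrable_sq]
        congr 1; ext y
        rw [Finset.sum_range_succ]; ring
      change ∫ y, (∑ i ∈ Finset.range (N + 1), X i y) ^ 2 ∂μ ≤ _
      rw [hexp, if_neg hN.ne']
      change ∫ y, X N y ^ 2 ∂μ ≤ _ at hdiag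
      linarith

theorem ae_tendsto_average_min (H : AlmostOrthogonalTruncations μ f γ C) {φ : ℕ → ℕ}
    (hφ : StrictMono φ) {r : ℕ → ℕ} (hr : ∀ i, r i ≤ i) {g : Ω → ℝ}
    (hg : ∀ᵐ y ∂μ, Tendsto (fun i => γ (r i) y) atTop (𝓝 (g y))) :
    ∀ᵐ y ∂μ, Tendsto (fun N : ℕ => (∑ i ∈ Finset.range N, min (f (φ i) y) (r i)) / N)
      atTop (𝓝 (g y)) := by
  refine ae_tendsto_average_of_sum_integral_sq_le (fun i y => min (f (φ i) y) (r i))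
    (fun i => γ (r i)) g
    (fun i => ae_of_all _ fun y => le_min (H.nonneg _ y) (Nat.cast_nonneg _))
    (fun i => H.memLp_sub _ _) _ (fun i => ?_) (if_pos rfl)
    (8 + 4 * C) (fun L => ?_) (H.integral_sum_sq_le hφ hr) hg
  · split_ifs
    · exact le_rfl
    · exact add_nonneg (by norm_num) (Finset.sum_nonneg fun j _ =>
        mul_nonneg (by positivity) (H.integral_increment_nonneg j))
  · refine le_trans (le_of_eq ?_) (sum_sum_range_div_sq_le H.integral_increment_nonneg
      H.sum_integral_increment_le L)
    symm
    refine Finset.sum_subset_zero_on_sdiff (fun i hi => ?_) (fun i hi => ?_) (fun i hi => ?_)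
    · exact Finset.mem_range.2 (Finset.mem_Ioo.1 hi).2
    · simp only [Finset.mem_sdiff, Finset.mem_range, Finset.mem_Ioo, not_and, not_lt] at hi
      have : i = 0 := by
        by_contra h
        exact absurd (hi.2 (Nat.pos_of_ne_zero h)) (not_le.2 hi.1)
      simp [this]
    · rw [if_neg (Finset.mem_Ioo.1 hi).1.ne']

/-- The truncation at the growing level `i` changes only finitely many terms almost everywhere. -/
theorem ae_eventually_le (H : AlmostOrthogonalTruncations μ f γ C) {φ : ℕ → ℕ}
    (hφ : StrictMono φ) : ∀ᵐ y ∂μ, ∀ᶠ i in atTop, f (φ i) y ≤ i := by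
  -- The summands below tend to `0` at almost every point, but the one of index `i` equals `1` where
  -- `f (φ (i + 1)) > i + 1`. This replaces the Borel–Cantelli lemma.
  have h1 : ∀ k a : ℕ, Integrable (fun y => min (f k y) (a : ℝ)) μ := fun k a =>
    (H.memLp_min k a).integrable (by norm_num)
  have hs : ∀ᵐ y ∂μ, Summable fun i : ℕ =>
      min (f (φ (i + 1)) y) ((i + 1 : ℕ) : ℝ) - min (f (φ (i + 1)) y) i := by
    refine ae_summable_of_sum_integral_le (B := C + 2)
      (fun i => (h1 (φ (i + 1)) (i + 1)).sub (h1 (φ (i + 1)) i)) (fun i => ae_of_all _ fun y => ?_)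
      (fun N => ?_)
    · exact sub_nonneg.2 (min_le_min_left _ (by push_cast; linarith))
    · calc _ ≤ ∑ i ∈ Finset.range N,
            (∫ y, (γ (i + 1) y - γ i y) ∂μ + (((i + 1 : ℕ) : ℝ) ^ 2)⁻¹) := by
            refine Finset.sum_le_sum fun i _ => ?_
            have hi : i + 1 ≤ φ (i + 1) := hφ.le_apply
            have hi' : ((i + 1 : ℕ) : ℝ) ≤ φ (i + 1) := by exact_mod_cast hi
            refine (H.incr (φ (i + 1)) (by omega) i (by omega)).trans ?_
            rw [one_div]
            gcongr
            linarith
        _ ≤ C + 2 := by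
            rw [Finset.sum_add_distrib]
            refine add_le_add (H.sum_integral_increment_le N) ?_
            have h2 := sum_Ioo_inv_sq_le (α := ℝ) 0 (N + 1)
            have h3 : ∑ i ∈ Finset.range N, (((i + 1 : ℕ) : ℝ) ^ 2)⁻¹
                = ∑ i ∈ Finset.Ioo 0 (N + 1), ((i : ℝ) ^ 2)⁻¹ := by
              rw [Finset.range_eq_Ico, Finset.sum_Ico_add' (fun i : ℕ => ((i : ℝ) ^ 2)⁻¹) 0 N 1]
              rfl
            rw [h3]
            simpa using h2
  filter_upwards [hs] with y hy
  rw [← map_add_atTop_eq_nat 1, eventually_map]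
  filter_upwards [hy.tendsto_atTop_zero.eventually_lt_const one_pos] with i hi
  by_contra hlt
  rw [not_le] at hlt
  have h3 : (i : ℝ) ≤ ((i + 1 : ℕ) : ℝ) := by push_cast; linarith
  rw [min_eq_right hlt.le, min_eq_right (h3.trans hlt.le)] at hi
  push_cast at hi
  linarith

end AlmostOrthogonalTruncations
end

/-! ### Komlós' theorem for finitely many nonnegative sequences -/

theorem tendsto_average_congr' {u v : ℕ → ℝ} {l : ℝ} (huv : u =ᶠ[atTop] v)
    (hu : Tendsto (fun N : ℕ => (∑ i ∈ Finset.range N, u i) / N) atTop (𝓝 l)) :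
    Tendsto (fun N : ℕ => (∑ i ∈ Finset.range N, v i) / N) atTop (𝓝 l) := by
  have h1 : Tendsto (fun i => v i - u i) atTop (𝓝 0) :=
    tendsto_const_nhds.congr' (huv.mono fun i hi => (sub_eq_zero.2 hi.symm).symm)
  have h2 := hu.add h1.cesaro
  rw [add_zero] at h2
  refine h2.congr fun N => ?_
  rw [Finset.sum_sub_distrib]
  ring

section
variable {Ω : Type*} [MeasurableSpace Ω] {μ : Measure Ω}

/-- Along every subsequence, the averages of `f k` converge a.e. to `g` and those of the truncations
`min (f k) a` to `γ a`, the limits being the same for all subsequences, and `γ a → g` a.e. as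
`a → ∞`. The null set may depend on the subsequence. -/
def HasStableAverages (μ : Measure Ω) (f : ℕ → Ω → ℝ) (γ : ℕ → Ω → ℝ) (g : Ω → ℝ) : Prop :=
  (∀ᵐ y ∂μ, Tendsto (fun a => γ a y) atTop (𝓝 (g y))) ∧
  ∀ φ : ℕ → ℕ, StrictMono φ → ∀ᵐ y ∂μ,
    (∀ a : ℕ, Tendsto (fun N : ℕ => (∑ i ∈ Finset.range N, min (f (φ i) y) a) / N)
      atTop (𝓝 (γ a y))) ∧
    Tendsto (fun N : ℕ => (∑ i ∈ Finset.range N, f (φ i) y) / N) atTop (𝓝 (g y))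

theorem HasStableAverages.comp {f γ : ℕ → Ω → ℝ} {g : Ω → ℝ} (h : HasStableAverages μ f γ g)
    {n : ℕ → ℕ} (hn : StrictMono n) : HasStableAverages μ (fun k => f (n k)) γ g :=
  ⟨h.1, fun φ hφ => h.2 (n ∘ φ) (hn.comp hφ)⟩

theorem AlmostOrthogonalTruncations.exists_hasStableAverages [IsFiniteMeasure μ]
    {f γ : ℕ → Ω → ℝ} {C : ℝ} (H : AlmostOrthogonalTruncations μ f γ C) :
    ∃ g, HasStableAverages μ f γ g := by
  obtain ⟨g, hg⟩ := H.exists_ae_tendsto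
  refine ⟨g, hg, fun φ hφ => ?_⟩
  have h1 : ∀ a : ℕ, ∀ᵐ y ∂μ, Tendsto
      (fun N : ℕ => (∑ i ∈ Finset.range N, min (f (φ i) y) (min i a : ℕ)) / N)
      atTop (𝓝 (γ a y)) := fun a =>
    H.ae_tendsto_average_min hφ (r := fun i => min i a) (fun i => min_le_left _ _)
      (ae_of_all _ fun y => tendsto_const_nhds.congr' <| by
        filter_upwards [eventually_ge_atTop a] with i hi
        rw [min_eq_right hi])
  filter_upwards [ae_all_iff.2 h1, H.ae_eventually_le hφ,
    H.ae_tendsto_average_min hφ (r := id) (fun i => le_rfl) hg] with y hy1 hy2 hy3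
  refine ⟨fun a => tendsto_average_congr' ?_ (hy1 a), tendsto_average_congr' ?_ hy3⟩
  · filter_upwards [eventually_ge_atTop a] with i hi
    rw [min_eq_right hi]
  · filter_upwards [hy2] with i hi
    exact min_eq_left hi

theorem exists_subseq_forall_hasStableAverages [MeasurableSpace.CountablyGenerated Ω]
    [IsFiniteMeasure μ] {ι : Type*} [Finite ι] {f : ι → ℕ → Ω → ℝ}
    (hf : ∀ i n, Integrable (f i n) μ) (h0 : ∀ i n y, 0 ≤ f i n y)
    {C : ℝ} (hC : ∀ i n, ∫ y, f i n y ∂μ ≤ C) :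
    ∃ n : ℕ → ℕ, StrictMono n ∧ ∀ i, ∃ γ g, HasStableAverages μ (fun k => f i (n k)) γ g := by
  classical
  have := Fintype.ofFinite ι
  suffices h : ∀ s : Finset ι, ∃ n : ℕ → ℕ, StrictMono n ∧
      ∀ i ∈ s, ∃ γ g, HasStableAverages μ (fun k => f i (n k)) γ g by
    obtain ⟨n, hn, h⟩ := h Finset.univ
    exact ⟨n, hn, fun i => h i (Finset.mem_univ i)⟩
  intro s
  induction s using Finset.induction_on with
  | empty => exact ⟨id, strictMono_id, by simp⟩
  | insert i s _ ih =>
    obtain ⟨n, hn, h⟩ := ih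
    obtain ⟨m, hm, γ, H⟩ := exists_subseq_almostOrthogonalTruncations (μ := μ)
      (f := fun k => f i (n k)) (fun k => hf _ _) (fun k => h0 _ _) (fun k => hC _ _)
    obtain ⟨g, hg⟩ := H.exists_hasStableAverages
    refine ⟨n ∘ m, hn.comp hm, fun j hj => ?_⟩
    rcases Finset.mem_insert.1 hj with rfl | hj
    · exact ⟨γ, g, hg⟩
    · obtain ⟨γ', g', h'⟩ := h j hj
      exact ⟨γ', g', h'.comp hm⟩

theorem integrable_of_ae_tendsto_of_integral_norm_le {E : Type*} [NormedAddCommGroup E]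
    {F : ℕ → Ω → E} {G : Ω → E} {C : ℝ} (hF : ∀ n, Integrable (F n) μ)
    (hC : ∀ n, ∫ y, ‖F n y‖ ∂μ ≤ C)
    (h : ∀ᵐ y ∂μ, Tendsto (fun n => F n y) atTop (𝓝 (G y))) : Integrable G μ := by
  refine ⟨aestronglyMeasurable_of_tendsto_ae _ (fun n => (hF n).1) h, ?_⟩
  calc ∫⁻ y, ‖G y‖ₑ ∂μ = ∫⁻ y, liminf (fun n => ‖F n y‖ₑ) atTop ∂μ :=
        lintegral_congr_ae (h.mono fun y hy => hy.enorm.liminf_eq.symm)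
    _ ≤ liminf (fun n => ∫⁻ y, ‖F n y‖ₑ ∂μ) atTop := lintegral_liminf_le' fun n => (hF n).1.enorm
    _ ≤ ENNReal.ofReal C := by
        refine liminf_le_of_le (by isBoundedDefault) fun b hb => ?_
        obtain ⟨n, hn⟩ := hb.exists
        refine hn.trans ?_
        rw [← ofReal_integral_norm_eq_lintegral_enorm (hF n)]
        exact ENNReal.ofReal_le_ofReal (hC n)
    _ < ⊤ := ENNReal.ofReal_lt_top
end

/-! ### Barycenters of narrow limits of empirical measures -/

/-- The continuous function of `‖x‖` that is `1` for `‖x‖ ≤ 2 (r + 1)`, is `0` for `‖x‖ ≥ 4 (r + 1)`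
and is affine in between. The shift `r + 1` keeps the scale positive for `r = 0`. -/
noncomputable def radialCutoff {E : Type*} [NormedAddCommGroup E] (r : ℕ) (x : E) : ℝ :=
  max 0 (min 1 (2 - ‖x‖ / (2 * ((r : ℝ) + 1))))

namespace radialCutoff
variable {E : Type*} [NormedAddCommGroup E]

theorem continuous (r : ℕ) : Continuous (radialCutoff r : E → ℝ) := by
  unfold radialCutoff; fun_prop

theorem nonneg (r : ℕ) (x : E) : 0 ≤ radialCutoff r x := le_max_left _ _

theorem le_one (r : ℕ) (x : E) : radialCutoff r x ≤ 1 :=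
  max_le zero_le_one (min_le_left _ _)

theorem eq_one {r : ℕ} {x : E} (h : ‖x‖ ≤ 2 * ((r : ℝ) + 1)) : radialCutoff r x = 1 := by
  have : ‖x‖ / (2 * ((r : ℝ) + 1)) ≤ 1 := div_le_one_of_le₀ h (by positivity)
  rw [radialCutoff, min_eq_left (by linarith), max_eq_right zero_le_one]

theorem hasCompactSupport [ProperSpace E] (r : ℕ) : HasCompactSupport (radialCutoff r : E → ℝ) := by
  refine HasCompactSupport.intro (isCompact_closedBall (0 : E) (4 * ((r : ℝ) + 1))) fun x hx => ?_
  rw [mem_closedBall_zero_iff, not_le] at hx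
  have : 2 ≤ ‖x‖ / (2 * ((r : ℝ) + 1)) := by
    rw [le_div_iff₀ (by positivity)]; linarith
  exact max_eq_left ((min_le_right _ _).trans (by linarith))

theorem tendsto_one (x : E) : Tendsto (fun r => radialCutoff r x) atTop (𝓝 1) := by
  refine tendsto_const_nhds.congr' ?_
  filter_upwards [eventually_ge_atTop ⌈‖x‖⌉₊] with r hr
  refine (eq_one ?_).symm
  have : ‖x‖ ≤ r := (Nat.le_ceil _).trans (by exact_mod_cast hr)
  linarith [norm_nonneg x]

/-- The part of the first moment that the cutoff removes is controlled by a truncation of the norm at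
half the radius at which the cutoff sets in. -/
theorem one_sub_mul_norm_le (r : ℕ) (x : E) :
    (1 - radialCutoff r x) * ‖x‖ ≤ 2 * (‖x‖ - min ‖x‖ ((r + 1 : ℕ) : ℝ)) := by
  rcases le_or_gt ‖x‖ (2 * ((r : ℝ) + 1)) with h | h
  · rw [eq_one h, sub_self, zero_mul]
    linarith [min_le_left ‖x‖ ((r + 1 : ℕ) : ℝ)]
  · have h1 := min_le_right ‖x‖ ((r + 1 : ℕ) : ℝ)
    push_cast at h1 ⊢
    nlinarith [nonneg r x, norm_nonneg x]

end radialCutoff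

/-- If the empirical measures of `x` converge narrowly to `ν`, their first moments converge, and the
tails `‖x i‖ - min ‖x i‖ a` are small in the mean for large `a`, then `ν` has a finite first moment
and its barycenter is the limit of the averages of `x`. -/
theorem integrable_id_and_eq_integral_of_tendsto_average {M : ℕ}
    {x : ℕ → EuclideanSpace ℝ (Fin M)} {ν : Measure (EuclideanSpace ℝ (Fin M))}
    [IsProbabilityMeasure ν] {w : EuclideanSpace ℝ (Fin M)} {c : ℝ} {γ : ℕ → ℝ}
    (hw : ∀ j, Tendsto (fun N : ℕ => (∑ i ∈ Finset.range N, x i j) / N) atTop (𝓝 (w j)))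
    (hc : Tendsto (fun N : ℕ => (∑ i ∈ Finset.range N, ‖x i‖) / N) atTop (𝓝 c))
    (hγ : ∀ a : ℕ, Tendsto (fun N : ℕ => (∑ i ∈ Finset.range N, min ‖x i‖ a) / N)
      atTop (𝓝 (γ a)))
    (hγc : Tendsto γ atTop (𝓝 c))
    (hν : ∀ g : EuclideanSpace ℝ (Fin M) → ℝ, Continuous g → HasCompactSupport g →
      Tendsto (fun N : ℕ => (∑ i ∈ Finset.range N, g (x i)) / N) atTop (𝓝 (∫ z, g z ∂ν))) :
    Integrable (fun z => z) ν ∧ w = ∫ z, z ∂ν := by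
  have hcpt : ∀ (r : ℕ) (u : EuclideanSpace ℝ (Fin M) → ℝ),
      HasCompactSupport fun z => radialCutoff r z * u z := fun r u =>
    (radialCutoff.hasCompactSupport r).mul_right
  have hbd : ∀ (r : ℕ) (u : EuclideanSpace ℝ (Fin M) → ℝ), Continuous u →
      Integrable (fun z => radialCutoff r z * u z) ν := fun r u hu =>
    ((radialCutoff.continuous r).mul hu).integrable_of_hasCompactSupport (hcpt r u)
  have hnorm : Integrable (fun z : EuclideanSpace ℝ (Fin M) => ‖z‖) ν := by
    refine integrable_of_ae_tendsto_of_integral_norm_le (C := c)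
      (fun r => hbd r _ continuous_norm) (fun r => ?_) (ae_of_all _ fun z => ?_)
    · have h1 : ∀ z : EuclideanSpace ℝ (Fin M),
          ‖radialCutoff r z * ‖z‖‖ = radialCutoff r z * ‖z‖ := fun z =>
        Real.norm_of_nonneg (mul_nonneg (radialCutoff.nonneg r z) (norm_nonneg z))
      simp_rw [h1]
      refine le_of_tendsto_of_tendsto'
        (hν _ ((radialCutoff.continuous r).mul continuous_norm) (hcpt r _)) hc fun N => ?_
      gcongr with i
      exact mul_le_of_le_one_left (norm_nonneg _) (radialCutoff.le_one r _)
    · simpa using (radialCutoff.tendsto_one z).mul_const ‖z‖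
  have hid : Integrable (fun z : EuclideanSpace ℝ (Fin M) => z) ν :=
    (integrable_norm_iff continuous_id.aestronglyMeasurable).1 hnorm
  refine ⟨hid, ?_⟩
  ext j
  have hproj : (∫ z, z ∂ν) j = ∫ z : EuclideanSpace ℝ (Fin M), z j ∂ν :=
    ((EuclideanSpace.proj (𝕜 := ℝ) j).integral_comp_comm hid).symm
  rw [hproj]
  have hcj : Continuous fun z : EuclideanSpace ℝ (Fin M) => z j :=
    (EuclideanSpace.proj (𝕜 := ℝ) j).continuous
  have hzj : ∀ z : EuclideanSpace ℝ (Fin M), |z j| ≤ ‖z‖ := fun z => PiLp.norm_apply_le z j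
  have hlim1 : Tendsto (fun r : ℕ => ∫ z : EuclideanSpace ℝ (Fin M), radialCutoff r z * z j ∂ν)
      atTop (𝓝 (∫ z : EuclideanSpace ℝ (Fin M), z j ∂ν)) := by
    refine tendsto_integral_of_dominated_convergence (fun z => ‖z‖)
      (fun r => (hbd r _ hcj).1) hnorm (fun r => ae_of_all _ fun z => ?_)
      (ae_of_all _ fun z => ?_)
    · rw [Real.norm_eq_abs, abs_mul, abs_of_nonneg (radialCutoff.nonneg r z)]
      exact (mul_le_of_le_one_left (abs_nonneg _) (radialCutoff.le_one r z)).trans (hzj z)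
    · simpa using (radialCutoff.tendsto_one z).mul_const (z j)
  have hlim2 : Tendsto (fun r : ℕ => ∫ z : EuclideanSpace ℝ (Fin M), radialCutoff r z * z j ∂ν)
      atTop (𝓝 (w j)) := by
    rw [tendsto_iff_dist_tendsto_zero]
    have hb : Tendsto (fun r : ℕ => 2 * (c - γ (r + 1))) atTop (𝓝 0) := by
      simpa using ((hγc.comp (tendsto_add_atTop_nat 1)).const_sub c).const_mul 2
    refine squeeze_zero (fun r => dist_nonneg) (fun r => ?_) hb
    have hl := ((hν _ ((radialCutoff.continuous r).mul hcj) (hcpt r _)).sub (hw j)).abs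
    have hr := (hc.sub (hγ (r + 1))).const_mul 2
    refine le_of_tendsto_of_tendsto' hl hr fun N => ?_
    rw [← sub_div, ← sub_div, mul_div_assoc', abs_div, Nat.abs_cast, ← Finset.sum_sub_distrib,
      ← Finset.sum_sub_distrib, Finset.mul_sum]
    gcongr
    refine (Finset.abs_sum_le_sum_abs _ _).trans (Finset.sum_le_sum fun i _ => ?_)
    refine le_trans ?_ (radialCutoff.one_sub_mul_norm_le r (x i))
    have h1 : radialCutoff r (x i) * x i j - x i j = -((1 - radialCutoff r (x i)) * x i j) := by
      ring
    have h2 : 0 ≤ 1 - radialCutoff r (x i) := sub_nonneg.2 (radialCutoff.le_one r _)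
    change |radialCutoff r (x i) * x i j - x i j| ≤ _
    rw [h1, abs_neg, abs_mul, abs_of_nonneg h2]
    exact mul_le_mul_of_nonneg_left (hzj _) h2
  exact tendsto_nhds_unique hlim2 hlim1

/-! ### The limit of the averages and its values -/

theorem integral_average_dirac {E : Type*} [MeasurableSpace E] [MeasurableSingletonClass E]
    (x : ℕ → E) (g : E → ℝ) (N : ℕ) :
    ∫ z, g z ∂(((N : ENNReal) + 1)⁻¹ • ∑ k ∈ Finset.range (N + 1), Measure.dirac (x k))
      = (∑ k ∈ Finset.range (N + 1), g (x k)) / ((N + 1 : ℕ) : ℝ) := by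
  rw [integral_smul_measure,
    integral_finsetSum_measure fun k _ => (integrable_dirac (by simp [enorm_lt_top]))]
  simp_rw [integral_dirac]
  rw [ENNReal.toReal_inv, ENNReal.toReal_add (by simp) (by simp), smul_eq_mul, div_eq_inv_mul]
  simp

theorem tendsto_average_succ {M : ℕ} {x : ℕ → EuclideanSpace ℝ (Fin M)}
    {w : EuclideanSpace ℝ (Fin M)}
    (h : ∀ j, Tendsto (fun N : ℕ => (∑ i ∈ Finset.range N, x i j) / N) atTop (𝓝 (w j))) :
    Tendsto (fun N : ℕ => ((N : ℝ) + 1)⁻¹ • ∑ k ∈ Finset.range (N + 1), x k) atTop (𝓝 w) := by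
  have h1 : Tendsto (fun N : ℕ => fun j => (∑ i ∈ Finset.range (N + 1), x i j) / ((N + 1 : ℕ) : ℝ))
      atTop (𝓝 (WithLp.ofLp w)) :=
    tendsto_pi_nhds.2 fun j => (h j).comp (tendsto_add_atTop_nat 1)
  refine (((PiLp.continuous_toLp 2 _).tendsto _).comp h1).congr fun N => ?_
  ext j
  simp [div_eq_inv_mul]

theorem average_mem_convexHull {E : Type*} [AddCommGroup E] [Module ℝ E] {S : Set E} {x : ℕ → E}
    (hx : ∀ i, x i ∈ S) (N : ℕ) :
    ((N : ℝ) + 1)⁻¹ • ∑ k ∈ Finset.range (N + 1), x k ∈ convexHull ℝ S := by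
  rw [Finset.smul_sum]
  refine (convex_convexHull ℝ S).sum_mem (fun _ _ => by positivity) ?_
    fun i _ => subset_convexHull ℝ S (hx i)
  rw [Finset.sum_const, Finset.card_range, nsmul_eq_mul]
  push_cast
  exact mul_inv_cancel₀ (by positivity)

theorem integrable_average {Ω E : Type*} [MeasurableSpace Ω] {μ : Measure Ω}
    [NormedAddCommGroup E] [NormedSpace ℝ E] {U : ℕ → Ω → E} (hU : ∀ n, Integrable (U n) μ)
    (N : ℕ) :
    Integrable (fun y => ((N : ℝ) + 1)⁻¹ • ∑ k ∈ Finset.range (N + 1), U k y) μ :=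
  Integrable.smul _ (integrable_finsetSum _ fun k _ => hU k)

theorem integral_norm_average_le {Ω E : Type*} [MeasurableSpace Ω] {μ : Measure Ω}
    [NormedAddCommGroup E] [NormedSpace ℝ E] {U : ℕ → Ω → E} (hU : ∀ n, Integrable (U n) μ) {C : ℝ}
    (hC : ∀ n, ∫ y, ‖U n y‖ ∂μ ≤ C) (N : ℕ) :
    ∫ y, ‖((N : ℝ) + 1)⁻¹ • ∑ k ∈ Finset.range (N + 1), U k y‖ ∂μ ≤ C := by
  calc ∫ y, ‖((N : ℝ) + 1)⁻¹ • ∑ k ∈ Finset.range (N + 1), U k y‖ ∂μ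
      ≤ ∫ y, ((N : ℝ) + 1)⁻¹ * ∑ k ∈ Finset.range (N + 1), ‖U k y‖ ∂μ := by
        refine integral_mono (integrable_average hU N).norm
          ((integrable_finsetSum _ fun k _ => (hU k).norm).const_mul _) fun y => ?_
        simp only
        rw [norm_smul, Real.norm_of_nonneg (by positivity)]
        gcongr
        exact norm_sum_le _ _
    _ = ((N : ℝ) + 1)⁻¹ * ∑ k ∈ Finset.range (N + 1), ∫ y, ‖U k y‖ ∂μ := by
        rw [integral_const_mul, integral_finsetSum _ fun k _ => (hU k).norm]
    _ ≤ ((N : ℝ) + 1)⁻¹ * ∑ k ∈ Finset.range (N + 1), C := by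
        gcongr
        exact hC _
    _ = C := by
        rw [Finset.sum_const, Finset.card_range, nsmul_eq_mul]
        push_cast
        field_simp

/-- Komlós' theorem for vector-valued functions, with stable averages of the norms in addition. -/
theorem exists_subseq_stable_average {Ω : Type*} [MeasurableSpace Ω]
    [MeasurableSpace.CountablyGenerated Ω] {μ : Measure Ω} [IsFiniteMeasure μ] {M : ℕ}
    {U : ℕ → Ω → EuclideanSpace ℝ (Fin M)} (hU : ∀ n, Integrable (U n) μ) {C : ℝ}
    (hC : ∀ n, ∫ y, ‖U n y‖ ∂μ ≤ C) :
    ∃ n : ℕ → ℕ, StrictMono n ∧ ∃ (W : Ω → EuclideanSpace ℝ (Fin M)) (γ : ℕ → Ω → ℝ) (g : Ω → ℝ),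
      HasStableAverages μ (fun k y => ‖U (n k) y‖) γ g ∧
      ∀ φ : ℕ → ℕ, StrictMono φ → ∀ᵐ y ∂μ, ∀ j,
        Tendsto (fun N : ℕ => (∑ i ∈ Finset.range N, U (n (φ i)) y j) / N) atTop (𝓝 (W y j)) := by
  let f : Option (Fin M × Bool) → ℕ → Ω → ℝ := fun i n y => match i with
    | none => ‖U n y‖
    | some (j, true) => max (U n y j) 0
    | some (j, false) => max (-U n y j) 0
  have hj : ∀ n j, Integrable (fun y => U n y j) μ := fun n j =>
    (EuclideanSpace.proj (𝕜 := ℝ) j).integrable_comp (hU n)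
  have hf : ∀ i n, Integrable (f i n) μ := by
    rintro (_ | ⟨j, _ | _⟩) n
    · exact (hU n).norm
    · exact (hj n j).neg.pos_part
    · exact (hj n j).pos_part
  have h0 : ∀ i n y, 0 ≤ f i n y := by
    rintro (_ | ⟨j, _ | _⟩) n y
    · exact norm_nonneg _
    · exact le_max_right _ _
    · exact le_max_right _ _
  have hle : ∀ i n y, f i n y ≤ ‖U n y‖ := by
    rintro (_ | ⟨j, _ | _⟩) n y
    · exact le_rfl
    · exact max_le ((neg_le_abs _).trans (PiLp.norm_apply_le (U n y) j)) (norm_nonneg _)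
    · exact max_le ((le_abs_self _).trans (PiLp.norm_apply_le (U n y) j)) (norm_nonneg _)
  obtain ⟨n, hn, h⟩ := exists_subseq_forall_hasStableAverages hf h0 fun i n =>
    (integral_mono (hf i n) (hU n).norm (hle i n)).trans (hC n)
  choose γ g hg using h
  refine ⟨n, hn, fun y => WithLp.toLp 2 fun j => g (some (j, true)) y - g (some (j, false)) y,
    γ none, g none, hg none, fun φ hφ => ?_⟩
  filter_upwards [ae_all_iff.2 fun i => (hg i).2 φ hφ] with y hy j
  refine ((hy (some (j, true))).2.sub (hy (some (j, false))).2).congr fun N => ?_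
  rw [← sub_div, ← Finset.sum_sub_distrib]
  congr 1
  refine Finset.sum_congr rfl fun i _ => ?_
  change max (U (n (φ i)) y j) 0 - max (-U (n (φ i)) y j) 0 = _
  exact max_zero_sub_max_neg_zero_eq_self _

theorem proposition3p3 {K M : ℕ}
    (Q : Set (EuclideanSpace ℝ (Fin K))) (hQ_open : IsOpen Q) (hQ_bdd : Bornology.IsBounded Q)
    (S : Set (EuclideanSpace ℝ (Fin M))) (hS : MeasurableSet S)
    (U : ℕ → EuclideanSpace ℝ (Fin K) → EuclideanSpace ℝ (Fin M))
    (hU : ∀ n, MemL1 Q S (U n))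
    (C : ℝ) (hC : ∀ n, ∫ y in Q, ‖U n y‖ ≤ C) :
    ∃ n : ℕ → ℕ, StrictMono n ∧
      ∃ W : EuclideanSpace ℝ (Fin K) → EuclideanSpace ℝ (Fin M),
        WeakKConverges Q (closure (convexHull ℝ S)) (fun k => U (n k)) W ∧
        ∀ᵐ y ∂(volume.restrict Q),
          Tendsto (fun N : ℕ => ((N : ℝ) + 1)⁻¹ • ∑ k ∈ Finset.range (N + 1), U (n k) y)
            atTop (𝓝 (W y)) := by
  have : IsFiniteMeasure (volume.restrict Q) :=
    isFiniteMeasure_restrict.2 hQ_bdd.measure_lt_top.ne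
  obtain ⟨n, hn, W, γ, g, hg, hW⟩ := exists_subseq_stable_average (fun n => (hU n).1) hC
  have hST : S ⊆ closure (convexHull ℝ S) := (subset_convexHull ℝ S).trans subset_closure
  have hav : ∀ᵐ y ∂(volume.restrict Q),
      Tendsto (fun N : ℕ => ((N : ℝ) + 1)⁻¹ • ∑ k ∈ Finset.range (N + 1), U (n k) y)
        atTop (𝓝 (W y)) :=
    (hW id strictMono_id).mono fun y hy => tendsto_average_succ hy
  refine ⟨n, hn, W, ⟨fun k => ⟨(hU _).1, (hU _).2.mono fun y hy => hST hy⟩, ⟨?_, ?_⟩, ?_⟩, hav⟩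
  · exact integrable_of_ae_tendsto_of_integral_norm_le
      (fun N => integrable_average (fun k => (hU (n k)).1) N)
      (fun N => integral_norm_average_le (fun k => (hU (n k)).1) (fun k => hC (n k)) N) hav
  · filter_upwards [hav, ae_all_iff.2 fun k => (hU k).2] with y hy hyS
    exact isClosed_closure.mem_of_tendsto hy
      (Eventually.of_forall fun N => subset_closure (average_mem_convexHull (fun k => hyS (n k)) N))
  · intro φ hφ V hV
    filter_upwards [hV.2.1.1, hV.2.2 id strictMono_id, hg.1, hg.2 φ hφ, hW φ hφ]
      with y hprob hnar hγ hgφ hWφ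
    have := hprob.1
    refine integrable_id_and_eq_integral_of_tendsto_average hWφ hgφ.2 hgφ.1 hγ fun u hu hsu => ?_
    refine (tendsto_add_atTop_iff_nat 1).1 ?_
    refine (hnar u hu hsu).congr fun N => ?_
    exact integral_average_dirac (fun k => U (n (φ k)) y) u N
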